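/- Let $V$ be the node set of a graph with a distance function $\delta\colon V\times V\to\mathbb N$, and let $\lambda$ be a probability distribution on $\mathbb N=\{0,1,2,\dots\}$. The graph is augmented with one long-range contact per node as follows: independently for every node $u$, a distance $r$ is drawn from $\lambda$, and then the long-range contact of $u$ is chosen uniformly at random among all nodes $v$ with $\delta(u,v)=r$ (if there is no such node, which can happen only in a finite graph, $u$ gets no long-range contact). Greedy routing from $s$ to $t$ starts at $s$ and, as long as the current node $u$ is not $t$, moves to a node that minimizes the distance $\delta(\cdot,t)$ among the neighbours of $u$ in the graph and the long-range contact of $u$. Ties are broken by an arbitrary rule, which may depend on $u$, on its long-range contact, and on the nodes visited before and their long-range contacts, but not on the contacts of nodes not yet visited. The greedy routing time is the number of steps until $t$ is reached. For every dimension $D\ge 2$ there is a constant $c>0$, depending only on $D$, such that the following hold for every distribution $\lambda$ on $\mathbb N$ and every tie-breaking rule. 1. (Infinite grid.) On $\mathbb Z^D$ with the Manhattan distance $\delta(u,v)=\|u-v\|_1$, where $u,v$ are adjacent if $\|u-v\|_1=1$, the expected greedy routing time from $s$ to $0$ is at least $c\,(\log_2\|s\|_1)^2$ for every $s\in\mathbb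 Z^D\setminus\{0\}$. 2. (Torus.) For every $n\ge1$, on the torus $(\mathbb Z/n\mathbb Z)^D$ (two distinct nodes are adjacent if they differ in exactly one coordinate, and there by $\pm1$ modulo $n$) with the shortest-path distance $\delta$, the expected greedy routing time from $s$ to $t$ is at least $c\,(\log_2\delta(s,t))^2$ for all $s\ne t$ with $\delta(s,t)\le n/4$. 3. (Finite grid.) For every $n\ge1$, on the grid $\{0,\dots,n-1\}^D$ with the edges induced from $\mathbb Z^D$ and the Manhattan distance, the expected greedy routing time from $s$ to $t$ is at least $c\,(\log_2\|s-t\|_1)^2$ for all $s\neq t$ such that both $s$ and $t$ have Manhattan distance at least $2\|s-t\|_1$ from every border node, i.e. from every node that has a coordinate equal to $0$ or $n-1$. -/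

import Mathlib

open MeasureTheory
open scoped ENNReal

noncomputable section

namespace SmallWorld

/-! ### Long range contacts -/

/-- The nodes at distance exactly `r` from `u`, for a distance function `δ`. -/
def sphere {V : Type*} (δ : V → V → ℕ) (u : V) (r : ℕ) : Set V :=
  {v | δ u v = r}

open Classical in
/-- A uniformly chosen node of the sphere of radius `r` around `u`. If there is no node at distance
`r` (this happens only in finite networks), then `u` gets no long range contact; this is encoded by
the value `u`, which is never of use to `u`. (All spheres of the networks below are finite.) -/
def uniformContact {V : Type*} (δ : V → V → ℕ) (u : V) (r : ℕ) : PMF V :=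
  if h : (sphere δ u r).Finite ∧ (sphere δ u r).Nonempty then
    PMF.uniformOfFinset h.1.toFinset (h.1.toFinset_nonempty.mpr h.2)
  else PMF.pure u

/-- The law of the long range contact of `u`: draw a distance `r` from `lam`, then a uniform node at
distance `r` from `u`. -/
def contactLaw {V : Type*} (δ : V → V → ℕ) (lam : PMF ℕ) (u : V) : PMF V :=
  lam.bind (uniformContact δ u)

/-- The law of the family of all long range contacts (`ω u` is the contact of `u`): they are chosen
independently for all nodes. -/
def contactMeasure {V : Type*} [MeasurableSpace V] (δ : V → V → ℕ) (lam : PMF ℕ) :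
    Measure (V → V) :=
  Measure.infinitePi fun u => (contactLaw δ lam u).toMeasure

/-! ### Greedy routing -/

/-- `next h u c` is the node to which `u`, whose long range contact is `c`, forwards the message;
`h` lists the nodes visited before `u`, each with its long range contact, most recent first.
The rule is greedy for the target `t` if the message always goes to a grid neighbour or to the
long range contact of `u`, and to one that minimizes the distance to `t`. Ties are broken in an
arbitrary way, which may depend on everything seen so far. -/
def IsGreedyRule {V : Type*} (G : SimpleGraph V) (δ : V → V → ℕ) (t : V)
    (next : List (V × V) → V → V → V) : Prop :=
  ∀ (h : List (V × V)) (u c : V), u ≠ t →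
    (G.Adj u (next h u c) ∨ next h u c = c) ∧
    ∀ w, (G.Adj u w ∨ w = c) → δ (next h u c) t ≤ δ w t

/-- History and position after `k` routing steps from `s`, when the contacts are given by `ω`. -/
def routeState {V : Type*} (next : List (V × V) → V → V → V) (s : V) (ω : V → V) :
    ℕ → List (V × V) × V
  | 0 => ([], s)
  | k + 1 =>
    let p := routeState next s ω k
    ((p.2, ω p.2) :: p.1, next p.1 p.2 (ω p.2))

/-- The number of steps until the message is at `t` for the first time (`∞` if it never is). -/
def routingTime {V : Type*} (next : List (V × V) → V → V → V) (s t : V) (ω : V → V) : ℝ≥0∞ :=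
  ⨅ (k : ℕ) (_ : (routeState next s ω k).2 = t), (k : ℝ≥0∞)

/-- The expected routing time from `s` to `t`. -/
def expectedRoutingTime {V : Type*} [MeasurableSpace V] (δ : V → V → ℕ) (lam : PMF ℕ)
    (next : List (V × V) → V → V → V) (s t : V) : ℝ≥0∞ :=
  ∫⁻ ω, routingTime next s t ω ∂(contactMeasure δ lam)

/-! ### The infinite grid -/

/-- The Manhattan norm on `ℤ^D`. -/
def l1norm {D : ℕ} (x : Fin D → ℤ) : ℕ := ∑ i, (x i).natAbs

/-- The Manhattan distance on `ℤ^D`. -/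
def manhattan {D : ℕ} (u v : Fin D → ℤ) : ℕ := l1norm (u - v)

/-- The infinite grid `ℤ^D`. -/
def latticeGraph (D : ℕ) : SimpleGraph (Fin D → ℤ) where
  Adj u v := manhattan u v = 1
  symm := ⟨fun u v h => by
    have e : manhattan v u = manhattan u v := by
      unfold manhattan l1norm
      refine Finset.sum_congr rfl fun i _ => ?_
      simp only [Pi.sub_apply]
      omega
    exact e.trans h⟩
  loopless := ⟨fun u h => by simp [manhattan, l1norm] at h⟩

theorem sphere_manhattan_finite {D : ℕ} (u : Fin D → ℤ) (r : ℕ) :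
    (sphere manhattan u r).Finite := by
  refine (Set.finite_Icc (fun i => u i - (r : ℤ)) (fun i => u i + (r : ℤ))).subset ?_
  intro v hv
  have hi : ∀ i, (u i - v i).natAbs ≤ r := fun i => by
    have hv' : ∑ i, (u i - v i).natAbs = r := hv
    rw [← hv']
    exact Finset.single_le_sum (f := fun i => (u i - v i).natAbs)
      (fun _ _ => Nat.zero_le _) (Finset.mem_univ i)
  constructor <;> intro i <;> have := hi i <;> simp only <;> omega

/-! ### The finite grid `{0, …, n-1}^D` -/

/-- A node of the finite grid as a node of `ℤ^D`. -/
def toLattice {D n : ℕ} (u : Fin D → Fin n) : Fin D → ℤ := fun i => ((u i : ℕ) : ℤ)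

/-- The Manhattan distance on the finite grid. -/
def gridDist {D n : ℕ} (u v : Fin D → Fin n) : ℕ := manhattan (toLattice u) (toLattice v)

/-- The finite grid, with the edges induced from `ℤ^D`. -/
def gridGraph (D n : ℕ) : SimpleGraph (Fin D → Fin n) := (latticeGraph D).comap toLattice

/-- The border of the finite grid. -/
def border (D n : ℕ) : Set (Fin D → Fin n) :=
  {b | ∃ i, (b i : ℕ) = 0 ∨ (b i : ℕ) + 1 = n}

/-! ### The finite torus -/

/-- The `D`-dimensional torus with side length `n`: two distinct nodes are adjacent if they agree
in all coordinates but one, where they differ by `1` modulo `n`. -/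
def torusGraph (D n : ℕ) : SimpleGraph (Fin D → ZMod n) where
  Adj u v := u ≠ v ∧ ∃ i, (∀ j, j ≠ i → u j = v j) ∧ (v i = u i + 1 ∨ u i = v i + 1)
  symm := ⟨fun _ _ h => ⟨h.1.symm, h.2.imp fun _ hi => ⟨fun j hj => (hi.1 j hj).symm, hi.2.symm⟩⟩⟩
  loopless := ⟨fun _ h => h.1 rfl⟩

/-- The shortest path distance on the torus. -/
def torusDist {D n : ℕ} (u v : Fin D → ZMod n) : ℕ := (torusGraph D n).dist u v

end SmallWorld

end

noncomputable section

namespace SmallWorld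

/-! ### The potential function -/

/-! The proof is an additive drift argument. A potential depending only on the distance to the
target is shown to drop by at most 1 in expectation per step, so its initial value bounds the
expected time from below (`le_lintegral_routingTimeFrom`).

Put κ(r, d) = min(r/d, √(d/r)), σ(d) = 1/d + K Σ_r λ(r) κ(r, d) and Φ(n) = Σ_{m ≤ n} 1/(m σ(m)).
Here σ bounds the relative progress at distance d: 1/d stands for the grid step, the sum for the
long-range contact. Each r helps only at distances d of its own order: Σ_d κ(r, d)/d ≤ 3. Hence Σ
σ(m)/m ≤ 2 + 3K for every λ, and Cauchy–Schwarz against Σ 1/m ≥ log n gives Φ(n) ≥ (log n)²/(2 + 3K)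
(`log_sq_le_sum_potentialStep`).

For the drift, geometry enters only through `HasSparseHits`: at distance d, a uniform contact at a
fixed distance comes closer than m to the target with probability at most C m/d. The tail √(d/r) of
κ, rather than a cutoff at d = r, makes σ(d)/√d nonincreasing, so σ(m) can be compared with σ(d) for
all m ≤ d; with K = 4C the expected drop is at most 1 (`potentialStep_add_tsum_le_one`,
`HasSparseHits.potential_le`).

The bound C m/d comes from `card_mul_l1norm_le`: shifting mass between two coordinates yields about
d/m disjoint copies of the hit set on the same sphere. This needs D ≥ 2. -/

/-- How much contacts at distance `r` help at distance `d` from the target. -/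
def progressKernel (r d : ℕ) : ℝ := min ((r : ℝ) / d) (√((d : ℝ) / r))

theorem progressKernel_nonneg (r d : ℕ) : 0 ≤ progressKernel r d :=
  le_min (by positivity) (Real.sqrt_nonneg _)

theorem progressKernel_zero_left (d : ℕ) : progressKernel 0 d = 0 := by
  simp [progressKernel]

theorem progressKernel_le (r d : ℕ) : progressKernel r d ≤ 1 := by
  unfold progressKernel
  rcases le_or_gt r d with h | h
  · refine (min_le_left _ _).trans (div_le_one_of_le₀ ?_ (by positivity))
    exact_mod_cast h
  · refine (min_le_right _ _).trans (Real.sqrt_le_one.mpr (div_le_one_of_le₀ ?_ (by positivity)))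
    exact_mod_cast h.le

/-- The right side is the integral of x^(-1/2) over [m, m + 1]. -/
theorem inv_sqrt_succ_le (m : ℕ) : 1 / √((m + 1 : ℕ) : ℝ) ≤ 2 * (√((m + 1 : ℕ) : ℝ) - √(m : ℝ)) := by
  have hb : 0 < √((m + 1 : ℕ) : ℝ) := Real.sqrt_pos.mpr (by positivity)
  have h1 := Real.sq_sqrt (Nat.cast_nonneg (α := ℝ) m)
  have h2 := Real.sq_sqrt (Nat.cast_nonneg (α := ℝ) (m + 1))
  rw [div_le_iff₀ hb]
  push_cast at *
  nlinarith [sq_nonneg (√((m : ℝ) + 1) - √(m : ℝ))]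

theorem sum_progressKernel_div_le_of_le {r n : ℕ} (h : n ≤ r) :
    ∑ d ∈ Finset.Ioc 0 n, progressKernel r d / d ≤ 2 * √(n : ℝ) / √(r : ℝ) := by
  induction n with
  | zero => simp
  | succ n ih =>
    rw [Finset.sum_Ioc_succ_top (Nat.zero_le n)]
    have hr : 0 < √(r : ℝ) := Real.sqrt_pos.mpr (by norm_cast; omega)
    have hn : 0 < √((n + 1 : ℕ) : ℝ) := Real.sqrt_pos.mpr (by positivity)
    have h1 : progressKernel r (n + 1) / ((n + 1 : ℕ) : ℝ) ≤ 1 / √((n + 1 : ℕ) : ℝ) / √(r : ℝ) := by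
      refine (div_le_div_of_nonneg_right (min_le_right _ _) (by positivity)).trans (le_of_eq ?_)
      rw [Real.sqrt_div (by positivity)]
      have h2 := Real.mul_self_sqrt (Nat.cast_nonneg (α := ℝ) (n + 1))
      conv_lhs => rw [← h2]
      rw [h2]
      field_simp
      rw [sq, h2]
    have h3 := div_le_div_of_nonneg_right (inv_sqrt_succ_le n) hr.le
    have h4 := ih (by omega)
    have h5 : 2 * √((n + 1 : ℕ) : ℝ) / √(r : ℝ) = 2 * √(n : ℝ) / √(r : ℝ) +
      2 * (√((n + 1 : ℕ) : ℝ) - √(n : ℝ)) / √(r : ℝ) := by ring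
    linarith

/-- Beyond r the terms are at most r/d², dominated by a telescoping difference of r/d. The
correction -r/n carries the induction, starting from the value 2 at n = r. -/
theorem sum_progressKernel_div_le_of_ge {r n : ℕ} (hr : 0 < r) (h : r ≤ n) :
    ∑ d ∈ Finset.Ioc 0 n, progressKernel r d / d ≤ 3 - (r : ℝ) / n := by
  have hr' : (0 : ℝ) < r := by exact_mod_cast hr
  induction n, h using Nat.le_induction with
  | base =>
    refine (sum_progressKernel_div_le_of_le le_rfl).trans (le_of_eq ?_)
    rw [mul_div_assoc, div_self (Real.sqrt_pos.mpr hr').ne', div_self hr'.ne']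
    norm_num
  | succ n hn ih =>
    rw [Finset.sum_Ioc_succ_top (Nat.zero_le n)]
    have hn' : (0 : ℝ) < n := by exact_mod_cast hr.trans_le hn
    have h1 : progressKernel r (n + 1) / ((n + 1 : ℕ) : ℝ) ≤ (r : ℝ) / n - r / ((n + 1 : ℕ) : ℝ) := by
      refine (div_le_div_of_nonneg_right (min_le_left _ _) (by positivity)).trans ?_
      push_cast
      rw [div_sub_div _ _ hn'.ne' (by positivity), div_div, div_le_div_iff₀ (by positivity) (by positivity)]
      nlinarith [mul_pos hr' hn']
    linarith

theorem sum_progressKernel_div_le (r n : ℕ) :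
    ∑ d ∈ Finset.Ioc 0 n, progressKernel r d / d ≤ 3 := by
  rcases Nat.eq_zero_or_pos r with rfl | hr
  · simp [progressKernel_zero_left]
  rcases le_total n r with h | h
  · refine (sum_progressKernel_div_le_of_le h).trans ?_
    have hr' : 0 < √(r : ℝ) := Real.sqrt_pos.mpr (by exact_mod_cast hr)
    rw [div_le_iff₀ hr']
    have : √(n : ℝ) ≤ √(r : ℝ) := Real.sqrt_le_sqrt (by exact_mod_cast h)
    linarith
  · refine (sum_progressKernel_div_le_of_ge hr h).trans ?_
    have : 0 ≤ (r : ℝ) / n := by positivity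
    linarith

/-- Divided by √d, the first branch of the kernel decreases in d and the second is constant. -/
theorem progressKernel_mul_sqrt_le {r m d : ℕ} (hm : 0 < m) (h : m ≤ d) :
    progressKernel r d * √(m : ℝ) ≤ progressKernel r m * √(d : ℝ) := by
  have hsq : √(m : ℝ) ≤ √(d : ℝ) := Real.sqrt_le_sqrt (by exact_mod_cast h)
  have hm' : (0 : ℝ) < m := by exact_mod_cast hm
  have hmd : (m : ℝ) ≤ d := by exact_mod_cast h
  unfold progressKernel
  rw [min_mul_of_nonneg _ _ (Real.sqrt_nonneg (d : ℝ)), min_mul_of_nonneg _ _ (Real.sqrt_nonneg (m : ℝ))]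
  refine min_le_min ?_ (le_of_eq ?_)
  · gcongr
  · rw [Real.sqrt_div (by positivity), Real.sqrt_div (by positivity)]
    ring

/-! ### Averaging the kernel over the distance law -/

theorem tsum_pmf_toReal {α : Type*} (p : PMF α) : ∑' a, (p a).toReal = 1 := by
  rw [← ENNReal.tsum_toReal_eq fun a => p.apply_ne_top a, p.tsum_coe, ENNReal.toReal_one]

theorem summable_pmf_mul {α : Type*} (p : PMF α) {f : α → ℝ} {B : ℝ} (h0 : ∀ a, 0 ≤ f a)
    (hB : ∀ a, f a ≤ B) : Summable fun a => (p a).toReal * f a := by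
  have hs : Summable fun a => (p a).toReal :=
    ENNReal.summable_toReal (by rw [p.tsum_coe]; exact ENNReal.one_ne_top)
  refine Summable.of_nonneg_of_le (fun a => mul_nonneg ENNReal.toReal_nonneg (h0 a)) (fun a => ?_)
    (hs.mul_right B)
  exact mul_le_mul_of_nonneg_left (hB a) ENNReal.toReal_nonneg

theorem tsum_pmf_mul_ofReal {α : Type*} (p : PMF α) {f : α → ℝ} {B : ℝ} (h0 : ∀ a, 0 ≤ f a)
    (hB : ∀ a, f a ≤ B) :
    ∑' a, p a * ENNReal.ofReal (f a) = ENNReal.ofReal (∑' a, (p a).toReal * f a) := by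
  rw [ENNReal.ofReal_tsum_of_nonneg (fun a => mul_nonneg ENNReal.toReal_nonneg (h0 a))
    (summable_pmf_mul p h0 hB)]
  refine tsum_congr fun a => ?_
  rw [ENNReal.ofReal_mul ENNReal.toReal_nonneg, ENNReal.ofReal_toReal (p.apply_ne_top a)]

/-- A bound for the expected relative progress of one routing step at distance `d` from the target,
made regular in `d`. -/
def speed (lam : PMF ℕ) (K : ℝ) (d : ℕ) : ℝ :=
  1 / d + K * ∑' r, (lam r).toReal * progressKernel r d

theorem tsum_progressKernel_nonneg (lam : PMF ℕ) (d : ℕ) :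
    0 ≤ ∑' r, (lam r).toReal * progressKernel r d :=
  tsum_nonneg fun r => mul_nonneg ENNReal.toReal_nonneg (progressKernel_nonneg r d)

theorem summable_progressKernel (lam : PMF ℕ) (d : ℕ) :
    Summable fun r => (lam r).toReal * progressKernel r d :=
  summable_pmf_mul lam (fun r => progressKernel_nonneg r d) (fun r => progressKernel_le r d)

theorem speed_pos (lam : PMF ℕ) {K : ℝ} (hK : 0 ≤ K) {d : ℕ} (hd : 0 < d) : 0 < speed lam K d := by
  have hd' : (0 : ℝ) < d := by exact_mod_cast hd
  have := mul_nonneg hK (tsum_progressKernel_nonneg lam d)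
  unfold speed
  positivity

theorem speed_mul_sqrt_le (lam : PMF ℕ) {K : ℝ} (hK : 0 ≤ K) {m d : ℕ} (hm : 0 < m) (h : m ≤ d) :
    speed lam K d * √(m : ℝ) ≤ speed lam K m * √(d : ℝ) := by
  have hsq : √(m : ℝ) ≤ √(d : ℝ) := Real.sqrt_le_sqrt (by exact_mod_cast h)
  have hm' : (0 : ℝ) < m := by exact_mod_cast hm
  have hmd : (m : ℝ) ≤ d := by exact_mod_cast h
  unfold speed
  rw [add_mul, add_mul, mul_assoc, mul_assoc, ← tsum_mul_right, ← tsum_mul_right]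
  refine add_le_add (by gcongr) (mul_le_mul_of_nonneg_left ?_ hK)
  refine Summable.tsum_le_tsum (fun r => ?_) ((summable_progressKernel lam d).mul_right _)
    ((summable_progressKernel lam m).mul_right _)
  rw [mul_assoc, mul_assoc]
  exact mul_le_mul_of_nonneg_left (progressKernel_mul_sqrt_le hm h) ENNReal.toReal_nonneg

theorem sum_one_div_sq_le (n : ℕ) : ∑ d ∈ Finset.Ioc 0 n, 1 / (d : ℝ) / d ≤ 2 := by
  have : ∀ n : ℕ, 0 < n → ∑ d ∈ Finset.Ioc 0 n, 1 / (d : ℝ) / d ≤ 2 - 1 / n := by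
    intro n hn
    induction n, Nat.succ_le_of_lt hn using Nat.le_induction with
    | base => norm_num
    | succ n hn' ih =>
      have hn0 : (0 : ℝ) < n := by exact_mod_cast hn'
      rw [Finset.sum_Ioc_succ_top (Nat.zero_le n)]
      have h1 : 1 / ((n + 1 : ℕ) : ℝ) / ((n + 1 : ℕ) : ℝ) ≤ 1 / (n : ℝ) - 1 / ((n + 1 : ℕ) : ℝ) := by
        push_cast
        rw [div_sub_div _ _ hn0.ne' (by positivity), div_div,
          div_le_div_iff₀ (by positivity) (by positivity)]
        nlinarith
      linarith [ih hn']
  rcases Nat.eq_zero_or_pos n with rfl | hn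
  · simp
  · have h0 : 0 ≤ 1 / (n : ℝ) := by positivity
    linarith [this n hn]

/-- After exchanging the two sums, each r contributes at most 3 times its probability. The total
speed on a logarithmic scale is thus bounded independently of `lam` and `n`. -/
theorem sum_speed_div_le (lam : PMF ℕ) {K : ℝ} (hK : 0 ≤ K) (n : ℕ) :
    ∑ d ∈ Finset.Ioc 0 n, speed lam K d / d ≤ 2 + 3 * K := by
  have h1 : ∑ d ∈ Finset.Ioc 0 n, (∑' r, (lam r).toReal * progressKernel r d) / (d : ℝ) ≤ 3 := by
    have hs : ∀ d ∈ Finset.Ioc 0 n, Summable fun r => (lam r).toReal * progressKernel r d / (d : ℝ) :=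
      fun d _ => (summable_progressKernel lam d).div_const _
    simp_rw [← tsum_div_const]
    rw [← Summable.tsum_finsetSum hs]
    have h3 : (3 : ℝ) = ∑' r, (lam r).toReal * 3 := by rw [tsum_mul_right, tsum_pmf_toReal, one_mul]
    rw [h3]
    refine Summable.tsum_le_tsum (fun r => ?_) (summable_sum hs)
      (summable_pmf_mul lam (fun _ => by norm_num) fun _ => le_rfl)
    simp_rw [mul_div_assoc]
    rw [← Finset.mul_sum]
    exact mul_le_mul_of_nonneg_left (sum_progressKernel_div_le r n) ENNReal.toReal_nonneg
  have h2 := sum_one_div_sq_le n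
  calc ∑ d ∈ Finset.Ioc 0 n, speed lam K d / d
      = ∑ d ∈ Finset.Ioc 0 n, 1 / (d : ℝ) / d +
        K * ∑ d ∈ Finset.Ioc 0 n, (∑' r, (lam r).toReal * progressKernel r d) / (d : ℝ) := by
        rw [Finset.mul_sum, ← Finset.sum_add_distrib]
        exact Finset.sum_congr rfl fun d _ => by unfold speed; ring
    _ ≤ 2 + 3 * K := by nlinarith

/-- The increment of the potential between distances `m - 1` and `m`. -/
def potentialStep (lam : PMF ℕ) (K : ℝ) (m : ℕ) : ℝ := 1 / (m * speed lam K m)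

theorem potentialStep_nonneg (lam : PMF ℕ) {K : ℝ} (hK : 0 ≤ K) (m : ℕ) :
    0 ≤ potentialStep lam K m := by
  rcases Nat.eq_zero_or_pos m with rfl | hm
  · simp [potentialStep]
  · have := speed_pos lam hK hm
    unfold potentialStep
    positivity

/-- Cauchy–Schwarz: 1/m is the geometric mean of `potentialStep lam K m` and `speed lam K m / m`,
and the latter has bounded sum. -/
theorem log_sq_le_sum_potentialStep (lam : PMF ℕ) {K : ℝ} (hK : 0 ≤ K) {n : ℕ} (hn : 0 < n) :
    Real.log n ^ 2 / (2 + 3 * K) ≤ ∑ m ∈ Finset.Ioc 0 n, potentialStep lam K m := by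
  have hlog : Real.log n ≤ ∑ m ∈ Finset.Ioc 0 n, 1 / (m : ℝ) := by
    have h := log_add_one_le_harmonic n
    rw [harmonic_eq_sum_Icc] at h
    push_cast at h
    have h2 : Real.log n ≤ Real.log (n + 1) :=
      Real.log_le_log (by exact_mod_cast hn) (by linarith)
    simp_rw [one_div]
    exact h2.trans h
  have hlog0 : 0 ≤ Real.log n := Real.log_natCast_nonneg n
  have hcs : (∑ m ∈ Finset.Ioc 0 n, 1 / (m : ℝ)) ^ 2 ≤
      (∑ m ∈ Finset.Ioc 0 n, potentialStep lam K m) * ∑ m ∈ Finset.Ioc 0 n, speed lam K m / m := by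
    refine Finset.sum_sq_le_sum_mul_sum_of_sq_le_mul _ (fun m _ => potentialStep_nonneg lam hK m)
      (fun m hm => ?_) (fun m hm => le_of_eq ?_)
    · have := speed_pos lam hK (Finset.mem_Ioc.mp hm).1
      positivity
    · have h1 := speed_pos lam hK (Finset.mem_Ioc.mp hm).1
      have h2 : (0 : ℝ) < m := by exact_mod_cast (Finset.mem_Ioc.mp hm).1
      unfold potentialStep
      field_simp
  rw [div_le_iff₀ (by positivity)]
  calc Real.log n ^ 2 ≤ (∑ m ∈ Finset.Ioc 0 n, 1 / (m : ℝ)) ^ 2 := by gcongr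
    _ ≤ _ := hcs
    _ ≤ _ := mul_le_mul_of_nonneg_left (sum_speed_div_le lam hK n)
      (Finset.sum_nonneg fun m _ => potentialStep_nonneg lam hK m)

/-- Growth no faster than m^(-1/2) towards 0 costs only a factor 2 over the constant value `f d`,
since √d (√d - √a) ≤ d - a. It is applied to the reciprocal of `speed`. -/
theorem sum_Ioc_le_of_mul_sqrt_le {f : ℕ → ℝ} {a d : ℕ} (had : a ≤ d) (h0 : 0 ≤ f d)
    (h : ∀ m, 0 < m → m ≤ d → f m * √(m : ℝ) ≤ f d * √(d : ℝ)) :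
    ∑ m ∈ Finset.Ioc a d, f m ≤ 2 * ((d : ℝ) - a) * f d := by
  have h1 : ∀ n, a ≤ n → ∑ m ∈ Finset.Ioc a n, 1 / √(m : ℝ) ≤ 2 * (√(n : ℝ) - √(a : ℝ)) := by
    intro n hn
    induction n, hn using Nat.le_induction with
    | base => simp
    | succ n hn ih =>
      rw [Finset.sum_Ioc_succ_top hn]
      linarith [inv_sqrt_succ_le n]
  have h2 : √(d : ℝ) * (√(d : ℝ) - √(a : ℝ)) ≤ (d : ℝ) - a := by
    have e1 := Real.mul_self_sqrt (Nat.cast_nonneg (α := ℝ) d)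
    have e2 := Real.mul_self_sqrt (Nat.cast_nonneg (α := ℝ) a)
    have e3 : √(a : ℝ) ≤ √(d : ℝ) := Real.sqrt_le_sqrt (by exact_mod_cast had)
    nlinarith [Real.sqrt_nonneg (a : ℝ)]
  calc ∑ m ∈ Finset.Ioc a d, f m ≤ ∑ m ∈ Finset.Ioc a d, f d * √(d : ℝ) * (1 / √(m : ℝ)) := by
        refine Finset.sum_le_sum fun m hm => ?_
        obtain ⟨hm1, hm2⟩ := Finset.mem_Ioc.mp hm
        have hm0 : 0 < √(m : ℝ) := Real.sqrt_pos.mpr (by exact_mod_cast (Nat.zero_le a).trans_lt hm1)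
        rw [mul_one_div, le_div_iff₀ hm0]
        exact h m (by omega) hm2
    _ = f d * √(d : ℝ) * ∑ m ∈ Finset.Ioc a d, 1 / √(m : ℝ) := by rw [Finset.mul_sum]
    _ ≤ f d * √(d : ℝ) * (2 * (√(d : ℝ) - √(a : ℝ))) :=
        mul_le_mul_of_nonneg_left (h1 d had) (mul_nonneg h0 (Real.sqrt_nonneg _))
    _ = 2 * (√(d : ℝ) * (√(d : ℝ) - √(a : ℝ))) * f d := by ring
    _ ≤ _ := by gcongr

/-! ### Expected drop of the potential in one step -/

/-- The truncated subtraction makes the numerator min(r, d). The factor 2 covers d < r < 2d, where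
√(d/r) is still at least 1/2. -/
theorem sub_sub_div_le_progressKernel {r d : ℕ} (hr : r < 2 * d) :
    ((d : ℝ) - (d - r : ℕ)) / d ≤ 2 * progressKernel r d := by
  have hd : (0 : ℝ) < d := by exact_mod_cast (by omega : 0 < d)
  rcases Nat.eq_zero_or_pos r with rfl | hr0
  · simp [progressKernel_zero_left]
  have hr0' : (0 : ℝ) < r := by exact_mod_cast hr0
  have hsub : (d : ℝ) ≤ (d - r : ℕ) + r := by exact_mod_cast (by omega : d ≤ d - r + r)
  have hr' : (r : ℝ) < 2 * d := by exact_mod_cast hr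
  have h1 : ((d : ℝ) - (d - r : ℕ)) / d ≤ (r : ℝ) / d := by
    gcongr
    linarith
  have h2 : ((d : ℝ) - (d - r : ℕ)) / d ≤ 2 * √((d : ℝ) / r) := by
    have h3 : (1 / 2 : ℝ) ≤ √((d : ℝ) / r) := by
      refine Real.le_sqrt_of_sq_le ?_
      rw [le_div_iff₀ hr0']
      linarith
    have h4 : ((d : ℝ) - (d - r : ℕ)) / d ≤ 1 := by
      rw [div_le_one hd]
      have : (0 : ℝ) ≤ (d - r : ℕ) := by positivity
      linarith
    linarith
  unfold progressKernel
  rw [mul_min_of_nonneg _ _ (by norm_num : (0 : ℝ) ≤ 2)]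
  refine le_min (h1.trans ?_) h2
  have : 0 ≤ (r : ℝ) / d := by positivity
  linarith

open Classical in
/-- A bound for the probability that a contact at distance `r` comes within distance less than `m`
of the target, at distance `d` from the target. -/
def hitBound (C : ℝ) (r d m : ℕ) : ℝ := if d < r + m ∧ r < 2 * d then C * m / d else 0

theorem hitBound_nonneg {C : ℝ} (hC : 0 ≤ C) (r d m : ℕ) : 0 ≤ hitBound C r d m := by
  unfold hitBound
  split_ifs <;> positivity

/-- The factor m in the hit probability cancels the m in `potentialStep`. What remains is C/d times
the sum of 1/`speed` over the at most min(r, d) values of m in (d - r, d], each comparable with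
1/`speed` at d. -/
theorem sum_potentialStep_mul_hitBound_le (lam : PMF ℕ) {C : ℝ} (hC : 0 ≤ C) {r d : ℕ}
    (hd : 0 < d) :
    ∑ m ∈ Finset.Ioo 0 d, potentialStep lam (4 * C) m * hitBound C r d m ≤
      1 / speed lam (4 * C) d * (4 * C * progressKernel r d) := by
  have hK : 0 ≤ 4 * C := by positivity
  have hs := fun m hm => speed_pos lam hK (d := m) hm
  have hd' : (0 : ℝ) < d := by exact_mod_cast hd
  by_cases hr : r < 2 * d
  · calc ∑ m ∈ Finset.Ioo 0 d, potentialStep lam (4 * C) m * hitBound C r d m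
        ≤ ∑ m ∈ Finset.Ioc (d - r) d, C / d * (1 / speed lam (4 * C) m) := by
          have hnn : ∀ m ∈ Finset.Ioc (d - r) d, 0 ≤ C / d * (1 / speed lam (4 * C) m) := by
            intro m hm
            have := hs m (by have := Finset.mem_Ioc.mp hm; omega)
            positivity
          refine (Finset.sum_le_sum (g := fun m => if m ∈ Finset.Ioc (d - r) d then
            C / d * (1 / speed lam (4 * C) m) else 0) fun m hm => ?_).trans ?_
          · obtain ⟨hm0, hmd⟩ := Finset.mem_Ioo.mp hm
            have hm0' : (0 : ℝ) < m := by exact_mod_cast hm0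
            have := hs m hm0
            unfold hitBound
            by_cases h : d < r + m
            · rw [if_pos ⟨h, hr⟩, if_pos (Finset.mem_Ioc.mpr ⟨by omega, hmd.le⟩)]
              refine le_of_eq ?_
              unfold potentialStep
              field_simp
            · rw [if_neg (fun h' => h h'.1), if_neg (fun h' => h (by have := Finset.mem_Ioc.mp h'; omega)), mul_zero]
          · rw [← Finset.sum_filter]
            exact Finset.sum_le_sum_of_subset_of_nonneg
              (fun m hm => (Finset.mem_filter.mp hm).2) (fun m hm _ => hnn m hm)
      _ = C / d * ∑ m ∈ Finset.Ioc (d - r) d, 1 / speed lam (4 * C) m := by rw [Finset.mul_sum]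
      _ ≤ C / d * (2 * ((d : ℝ) - (d - r : ℕ)) * (1 / speed lam (4 * C) d)) := by
          refine mul_le_mul_of_nonneg_left (sum_Ioc_le_of_mul_sqrt_le (Nat.sub_le d r)
            (by have := hs d hd; positivity) fun m hm hmd => ?_) (by positivity)
          have h1 := hs m hm
          have h2 := hs d hd
          rw [one_div_mul_eq_div, one_div_mul_eq_div, div_le_div_iff₀ h1 h2]
          have := speed_mul_sqrt_le lam hK hm hmd
          linarith
      _ = 2 * C * (1 / speed lam (4 * C) d) * (((d : ℝ) - (d - r : ℕ)) / d) := by ring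
      _ ≤ 2 * C * (1 / speed lam (4 * C) d) * (2 * progressKernel r d) :=
          mul_le_mul_of_nonneg_left (sub_sub_div_le_progressKernel hr)
            (by have := hs d hd; positivity)
      _ = _ := by ring
  · have : ∀ m ∈ Finset.Ioo 0 d, potentialStep lam (4 * C) m * hitBound C r d m = 0 := by
      intro m _
      rw [hitBound, if_neg (fun h => hr h.2), mul_zero]
    rw [Finset.sum_eq_zero this]
    have := hs d hd
    have := progressKernel_nonneg r d
    positivity

theorem potentialStep_add_tsum_le_one (lam : PMF ℕ) {C : ℝ} (hC : 0 ≤ C) {d : ℕ} (hd : 0 < d) :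
    ENNReal.ofReal (potentialStep lam (4 * C) d) +
      ∑ m ∈ Finset.Ioo 0 d, ENNReal.ofReal (potentialStep lam (4 * C) m) *
        ∑' r, lam r * ENNReal.ofReal (hitBound C r d m) ≤ 1 := by
  have hK : 0 ≤ 4 * C := by positivity
  have hw := potentialStep_nonneg lam hK
  have hs := speed_pos lam hK hd
  have hd' : (0 : ℝ) < d := by exact_mod_cast hd
  have h1 : ∑ m ∈ Finset.Ioo 0 d, ENNReal.ofReal (potentialStep lam (4 * C) m) *
        ∑' r, lam r * ENNReal.ofReal (hitBound C r d m) ≤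
      ENNReal.ofReal (∑' r, (lam r).toReal *
        (1 / speed lam (4 * C) d * (4 * C * progressKernel r d))) := by
    calc _ = ∑' r, lam r * ENNReal.ofReal (∑ m ∈ Finset.Ioo 0 d,
              potentialStep lam (4 * C) m * hitBound C r d m) := by
          simp_rw [← ENNReal.tsum_mul_left]
          rw [← Summable.tsum_finsetSum fun _ _ => ENNReal.summable]
          refine tsum_congr fun r => ?_
          rw [ENNReal.ofReal_sum_of_nonneg fun m _ => mul_nonneg (hw m) (hitBound_nonneg hC r d m),
            Finset.mul_sum]
          refine Finset.sum_congr rfl fun m _ => ?_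
          rw [ENNReal.ofReal_mul (hw m)]
          ring
      _ ≤ ∑' r, lam r * ENNReal.ofReal (1 / speed lam (4 * C) d * (4 * C * progressKernel r d)) :=
          ENNReal.tsum_le_tsum fun r => mul_le_mul_right
            (ENNReal.ofReal_le_ofReal (sum_potentialStep_mul_hitBound_le lam hC hd)) _
      _ = _ := tsum_pmf_mul_ofReal lam (B := 1 / speed lam (4 * C) d * (4 * C * 1))
          (fun r => by have := progressKernel_nonneg r d; positivity)
          (fun r => by have := progressKernel_le r d; gcongr)
  refine (add_le_add_right h1 _).trans ?_
  rw [← ENNReal.ofReal_add (hw d) (tsum_nonneg fun r => by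
    have := progressKernel_nonneg r d
    have := ENNReal.toReal_nonneg (a := lam r)
    positivity), ← ENNReal.ofReal_one]
  refine ENNReal.ofReal_le_ofReal (le_of_eq ?_)
  have h2 : ∑' r, (lam r).toReal * (1 / speed lam (4 * C) d * (4 * C * progressKernel r d)) =
      1 / speed lam (4 * C) d * (4 * C * ∑' r, (lam r).toReal * progressKernel r d) := by
    rw [← tsum_mul_left, ← tsum_mul_left]
    exact tsum_congr fun r => by ring
  have h3 : potentialStep lam (4 * C) d = 1 / speed lam (4 * C) d * (1 / d) := by
    unfold potentialStep
    rw [one_div_mul_one_div, mul_comm]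
  rw [h2, h3, ← mul_add]
  -- With K = 4C the grid-step and contact terms add up exactly to `speed` at d.
  change 1 / speed lam (4 * C) d * speed lam (4 * C) d = 1
  exact one_div_mul_cancel hs.ne'

/-! ### Routing from an arbitrary state -/

section Routing

variable {V : Type*}

/-- One step of routing. -/
def routeStep (next : List (V × V) → V → V → V) (ω : V → V) (p : List (V × V) × V) :
    List (V × V) × V :=
  ((p.2, ω p.2) :: p.1, next p.1 p.2 (ω p.2))

/-- The number of steps to reach `t` from the state `p`. -/
def routingTimeFrom (next : List (V × V) → V → V → V) (t : V) (p : List (V × V) × V)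
    (ω : V → V) : ℝ≥0∞ :=
  ⨅ (k : ℕ) (_ : ((routeStep next ω)^[k] p).2 = t), (k : ℝ≥0∞)

theorem routeState_eq_iterate (next : List (V × V) → V → V → V) (s : V) (ω : V → V) (k : ℕ) :
    routeState next s ω k = (routeStep next ω)^[k] ([], s) := by
  induction k with
  | zero => rfl
  | succ k ih => rw [Function.iterate_succ_apply', ← ih]; rfl

theorem routingTime_eq (next : List (V × V) → V → V → V) (s t : V) (ω : V → V) :
    routingTime next s t ω = routingTimeFrom next t ([], s) ω := by
  simp only [routingTime, routingTimeFrom, routeState_eq_iterate]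

theorem one_add_routingTimeFrom_le {next : List (V × V) → V → V → V} {t : V}
    {p : List (V × V) × V} (hp : p.2 ≠ t) (ω : V → V) :
    1 + routingTimeFrom next t (routeStep next ω p) ω ≤ routingTimeFrom next t p ω := by
  refine le_iInf₂ fun k hk => ?_
  cases k with
  | zero => exact absurd hk hp
  | succ k =>
    rw [Nat.cast_succ, add_comm]
    exact add_le_add_left (iInf₂_le k hk) 1

/-- Splitting over the countably many values of the current contact makes the next state
deterministic. -/
theorem measurableSet_iterate_eq [Countable V] [MeasurableSpace V] [MeasurableSingletonClass V]
    (next : List (V × V) → V → V → V) (t : V) (k : ℕ) (p : List (V × V) × V) :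
    MeasurableSet {ω : V → V | ((routeStep next ω)^[k] p).2 = t} := by
  induction k generalizing p with
  | zero =>
    simp only [Function.iterate_zero, id_eq]
    exact MeasurableSet.const _
  | succ k ih =>
    have : {ω : V → V | ((routeStep next ω)^[k + 1] p).2 = t} =
        ⋃ c : V, {ω | ω p.2 = c} ∩
          {ω | ((routeStep next ω)^[k] ((p.2, c) :: p.1, next p.1 p.2 c)).2 = t} := by
      ext ω
      simp [routeStep]
    rw [this]
    exact MeasurableSet.iUnion fun c =>
      (measurableSet_eq_fun (measurable_pi_apply p.2) measurable_const).inter (ih _)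

theorem measurable_routingTimeFrom [Countable V] [MeasurableSpace V] [MeasurableSingletonClass V]
    (next : List (V × V) → V → V → V) (t : V) (p : List (V × V) × V) :
    Measurable (routingTimeFrom next t p) := by
  classical
  have : routingTimeFrom next t p = fun ω => ⨅ k : ℕ,
      if ((routeStep next ω)^[k] p).2 = t then (k : ℝ≥0∞) else ⊤ := by
    funext ω
    exact iInf_congr fun k => by split_ifs with h <;> simp [h]
  rw [this]
  exact Measurable.iInf fun k =>
    Measurable.ite (measurableSet_iterate_eq next t k p) measurable_const measurable_const

/-- If routing strictly decreases `f`, it only consults the contacts of nodes with `f`-value at most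
that of the current node. -/
theorem routeStep_iterate_congr {next : List (V × V) → V → V → V} {t : V} {f : V → ℕ}
    (hf : ∀ h u c, u ≠ t → f (next h u c) < f u) {ω ω' : V → V} {k : ℕ} {p : List (V × V) × V}
    (hω : ∀ v, f v ≤ f p.2 → ω v = ω' v) (hk : ((routeStep next ω)^[k] p).2 = t) :
    ∃ j ≤ k, ((routeStep next ω')^[j] p).2 = t := by
  induction k generalizing p with
  | zero => exact ⟨0, le_rfl, hk⟩
  | succ k ih =>
    by_cases hp : p.2 = t
    · exact ⟨0, Nat.zero_le _, hp⟩
    have hstep : routeStep next ω p = routeStep next ω' p := by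
      simp only [routeStep, hω p.2 le_rfl]
    obtain ⟨j, hj, h⟩ := ih (p := routeStep next ω p)
      (fun v hv => hω v (hv.trans (hf p.1 p.2 _ hp).le)) hk
    exact ⟨j + 1, by omega, by rw [Function.iterate_succ_apply, ← hstep]; exact h⟩

theorem routingTimeFrom_congr {next : List (V × V) → V → V → V} {t : V} {f : V → ℕ}
    (hf : ∀ h u c, u ≠ t → f (next h u c) < f u) {ω ω' : V → V} {p : List (V × V) × V}
    (hω : ∀ v, f v ≤ f p.2 → ω v = ω' v) :
    routingTimeFrom next t p ω = routingTimeFrom next t p ω' := by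
  have key : ∀ ω ω' : V → V, (∀ v, f v ≤ f p.2 → ω v = ω' v) →
      routingTimeFrom next t p ω ≤ routingTimeFrom next t p ω' := by
    intro ω ω' hω
    refine le_iInf₂ fun k hk => ?_
    obtain ⟨j, hj, h⟩ := routeStep_iterate_congr hf (fun v hv => (hω v hv).symm) hk
    exact (iInf₂_le j h).trans (by exact_mod_cast hj)
  exact le_antisymm (key _ _ hω) (key _ _ fun v hv => (hω v hv).symm)

end Routing

/-! ### Resampling one coordinate of a product measure -/

-- A product measure is determined by its values on finite boxes. The resampled coordinate either
-- contributes its own factor or is unconstrained.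
open Classical in
theorem infinitePi_map_update {ι : Type*} {X : ι → Type*} [∀ i, MeasurableSpace (X i)]
    (μ : ∀ i, Measure (X i)) [∀ i, IsProbabilityMeasure (μ i)] (i : ι) :
    (((Measure.infinitePi μ).prod (μ i)).map fun q => Function.update q.1 i q.2) =
      Measure.infinitePi μ := by
  have hmeas : Measurable fun q : (∀ j, X j) × X i => Function.update q.1 i q.2 :=
    measurable_update'
  refine Measure.eq_infinitePi μ fun s t ht => ?_
  rw [Measure.map_apply hmeas (MeasurableSet.pi s.countable_toSet fun j _ => ht j)]
  by_cases hi : i ∈ s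
  · have : (fun q : (∀ j, X j) × X i => Function.update q.1 i q.2) ⁻¹' ((s : Set ι).pi t) =
        (((s.erase i : Finset ι) : Set ι).pi t) ×ˢ t i := by
      ext ⟨ω, c⟩
      simp only [Set.mem_preimage, Set.mem_pi, Set.mem_prod, Finset.coe_erase, Set.mem_sdiff,
        Set.mem_singleton_iff, Finset.mem_coe]
      constructor
      · intro h
        refine ⟨fun j hj => ?_, by simpa using h i hi⟩
        simpa [Function.update_of_ne hj.2] using h j hj.1
      · rintro ⟨h1, h2⟩ j hj
        by_cases hji : j = i
        · subst hji; simpa using h2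
        · simpa [Function.update_of_ne hji] using h1 j ⟨hj, hji⟩
    rw [this, Measure.prod_prod, Measure.infinitePi_pi μ fun j _ => ht j,
      Finset.prod_erase_mul _ _ hi]
  · have : (fun q : (∀ j, X j) × X i => Function.update q.1 i q.2) ⁻¹' ((s : Set ι).pi t) =
        ((s : Set ι).pi t) ×ˢ Set.univ := by
      ext ⟨ω, c⟩
      simp only [Set.mem_preimage, Set.mem_pi, Set.mem_prod, Finset.mem_coe, Set.mem_univ, and_true]
      refine forall₂_congr fun j hj => ?_
      rw [Function.update_of_ne (by rintro rfl; exact hi hj)]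
    rw [this, Measure.prod_prod, Measure.infinitePi_pi μ fun j _ => ht j, measure_univ, mul_one]

-- Deferred decisions: the contact of `u` may be drawn afresh, independently of the rest, when `u`
-- is reached.
open Classical in
theorem lintegral_contactMeasure_resample {V : Type*} [Countable V] [MeasurableSpace V]
    [MeasurableSingletonClass V] (δ : V → V → ℕ) (lam : PMF ℕ) (u : V) {g : (V → V) → ℝ≥0∞}
    (hg : Measurable g) :
    ∫⁻ ω, g ω ∂contactMeasure δ lam =
      ∑' c, contactLaw δ lam u c * ∫⁻ ω, g (Function.update ω u c) ∂contactMeasure δ lam := by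
  have hmeas : Measurable fun q : (V → V) × V => Function.update q.1 u q.2 :=
    measurable_update'
  have : ∀ v, IsProbabilityMeasure (contactLaw δ lam v).toMeasure := fun v => inferInstance
  have h := infinitePi_map_update (fun v => (contactLaw δ lam v).toMeasure) u
  conv_lhs => rw [contactMeasure, ← h]
  rw [lintegral_map hg hmeas,
    lintegral_prod_symm' (fun q => g (Function.update q.1 u q.2)) (hg.comp hmeas),
    lintegral_countable']
  refine tsum_congr fun c => ?_
  rw [PMF.toMeasure_apply_singleton _ _ (measurableSet_singleton c), mul_comm]
  rfl

/-! ### The additive drift argument -/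

/-- Strong induction on `f u`, over all histories at once, after revealing the contact of `u`. The
drift condition is additive because subtraction in `ℝ≥0∞` truncates. -/
theorem le_lintegral_routingTimeFrom {V : Type*} [Countable V] [MeasurableSpace V]
    [MeasurableSingletonClass V] (δ : V → V → ℕ) (lam : PMF ℕ)
    {next : List (V × V) → V → V → V} {t : V} {f : V → ℕ} {R : ℕ} (Φ : V → ℝ≥0∞) (ht : Φ t = 0)
    (hf : ∀ h u c, u ≠ t → f (next h u c) < f u)
    (hΦ : ∀ h u, u ≠ t → f u ≤ R → Φ u ≤ 1 + ∑' c, contactLaw δ lam u c * Φ (next h u c))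
    (h : List (V × V)) (u : V) (hu : f u ≤ R) :
    Φ u ≤ ∫⁻ ω, routingTimeFrom next t (h, u) ω ∂contactMeasure δ lam := by
  classical
  have hprob : IsProbabilityMeasure (contactMeasure δ lam) := by
    unfold contactMeasure; infer_instance
  induction hn : f u using Nat.strong_induction_on generalizing h u with
  | _ n ih =>
    by_cases hut : u = t
    · rw [hut, ht]; exact zero_le
    rw [lintegral_contactMeasure_resample δ lam u (measurable_routingTimeFrom next t (h, u))]
    calc Φ u ≤ 1 + ∑' c, contactLaw δ lam u c * Φ (next h u c) := hΦ h u hut hu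
      _ = ∑' c, contactLaw δ lam u c * (1 + Φ (next h u c)) := by
          simp_rw [mul_add, mul_one]
          rw [ENNReal.tsum_add, PMF.tsum_coe]
      _ ≤ _ := by
          refine ENNReal.tsum_le_tsum fun c => mul_le_mul_right ?_ _
          have hlt := hf h u c hut
          have h1 := ih (f (next h u c)) (hn ▸ hlt) ((u, c) :: h) (next h u c) (hlt.le.trans hu) rfl
          calc 1 + Φ (next h u c)
              ≤ 1 + ∫⁻ ω, routingTimeFrom next t ((u, c) :: h, next h u c) ω ∂contactMeasure δ lam :=
                add_le_add_right h1 1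
            _ = ∫⁻ ω, (1 + routingTimeFrom next t ((u, c) :: h, next h u c) ω)
                  ∂contactMeasure δ lam := by
                rw [lintegral_add_left measurable_const, lintegral_const, measure_univ, mul_one]
            _ ≤ _ := by
                refine lintegral_mono fun ω => ?_
                have h2 := one_add_routingTimeFrom_le (next := next) (t := t) (p := (h, u)) hut
                  (Function.update ω u c)
                refine le_trans (le_of_eq ?_) h2
                have h3 : routeStep next (Function.update ω u c) (h, u) =
                    ((u, c) :: h, next h u c) := by simp [routeStep]
                rw [h3]
                congr 1
                -- From the next node on, only nodes with `f`-value below `f u` are consulted, so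
                -- the contact fixed at `u` no longer matters.
                refine routingTimeFrom_congr hf fun v hv => ?_
                rw [Function.update_of_ne]
                rintro rfl
                exact absurd hv (not_le.mpr hlt)

/-! ### Greedy routing -/

/-- The geometry behind the lower bound: a node `u` at distance at most `R` from `t` reaches, among
the nodes at any fixed distance from `u`, those within distance less than `m` of `t` with
probability at most `C * m / δ u t`. -/
structure HasSparseHits {V : Type*} (G : SimpleGraph V) (δ : V → V → ℕ) (t : V) (R C : ℕ) :
    Prop where
  self : δ t t = 0
  adj : ∀ u w, G.Adj u w → δ u t ≤ δ w t + 1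
  closer : ∀ u, u ≠ t → ∃ w, G.Adj u w ∧ δ w t < δ u t
  triangle : ∀ u v, δ u t ≤ δ u v + δ v t
  triangle' : ∀ u v, δ u v ≤ δ u t + δ v t
  count : ∀ (u : V) (r m : ℕ), δ u t ≤ R → 0 < m → m < δ u t → ∀ S A : Finset V,
    (∀ v ∈ A, δ u v = r ∧ δ v t < m) → (∀ v, δ u v = r → v ∈ S) →
    A.card * δ u t ≤ C * m * S.card

section Greedy

variable {V : Type*} {G : SimpleGraph V} {δ : V → V → ℕ} {t : V} {R C : ℕ}

open Classical in
theorem HasSparseHits.tsum_uniformContact_le (H : HasSparseHits G δ t R C) {u : V}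
    (hu : δ u t ≤ R) (r : ℕ) {m : ℕ} (hm : 0 < m) (hmd : m < δ u t) :
    ∑' c, uniformContact δ u r c * (if δ c t < m then 1 else 0) ≤
      ENNReal.ofReal (hitBound C r (δ u t) m) := by
  unfold uniformContact
  split_ifs with h
  · set S := h.1.toFinset with hS
    have hmem : ∀ v, v ∈ S ↔ δ u v = r := fun v => by simp [hS, sphere]
    have hSne : S.Nonempty := h.1.toFinset_nonempty.mpr h.2
    have hScard : (0 : ℝ) < S.card := by exact_mod_cast hSne.card_pos
    have hsum : ∑' c, PMF.uniformOfFinset S hSne c * (if δ c t < m then 1 else 0) =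
        ((S.filter fun v => δ v t < m).card : ℝ≥0∞) * (S.card : ℝ≥0∞)⁻¹ := by
      rw [tsum_eq_sum (s := S.filter fun v => δ v t < m)]
      · rw [Finset.sum_congr rfl (g := fun _ => (S.card : ℝ≥0∞)⁻¹), Finset.sum_const, nsmul_eq_mul]
        intro c hc
        have := Finset.mem_filter.mp hc
        simp [this.1, this.2]
      · intro c hc
        rw [Finset.mem_filter, not_and_or] at hc
        rcases hc with hc | hc <;> simp [hc]
    have hsum' : ((S.filter fun v => δ v t < m).card : ℝ≥0∞) * (S.card : ℝ≥0∞)⁻¹ =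
        ENNReal.ofReal ((S.filter fun v => δ v t < m).card / S.card : ℝ) := by
      rw [ENNReal.ofReal_div_of_pos hScard, ENNReal.ofReal_natCast, ENNReal.ofReal_natCast,
        div_eq_mul_inv]
    rw [hsum, hsum']
    refine ENNReal.ofReal_le_ofReal ?_
    unfold hitBound
    split_ifs with hr
    · have hd : (0 : ℝ) < δ u t := by exact_mod_cast hm.trans hmd
      rw [div_le_div_iff₀ hScard hd]
      exact_mod_cast H.count u r m hu hm hmd S (S.filter fun v => δ v t < m)
        (fun v hv => by rw [Finset.mem_filter, hmem] at hv; exact hv)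
        (fun v hv => (hmem v).mpr hv)
    -- Outside this range of r the two triangle inequalities exclude any hit.
    · rw [Finset.filter_eq_empty_iff.mpr, Finset.card_empty, Nat.cast_zero, zero_div]
      intro v hv hvm
      rw [hmem] at hv
      have h1 := H.triangle u v
      have h2 := H.triangle' u v
      exact hr ⟨by omega, by omega⟩
  -- Without a contact the value is `u` itself, which is not within distance less than m.
  · refine le_of_eq_of_le ?_ zero_le
    refine ENNReal.tsum_eq_zero.mpr fun c => ?_
    rw [PMF.pure_apply]
    by_cases hc : c = u
    · subst hc; simp [not_lt.mpr hmd.le]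
    · simp [hc]

open Classical in
theorem HasSparseHits.tsum_contactLaw_le (H : HasSparseHits G δ t R C) (lam : PMF ℕ) {u : V}
    (hu : δ u t ≤ R) {m : ℕ} (hm : 0 < m) (hmd : m < δ u t) :
    ∑' c, contactLaw δ lam u c * (if δ c t < m then 1 else 0) ≤
      ∑' r, lam r * ENNReal.ofReal (hitBound C r (δ u t) m) := by
  calc ∑' c, contactLaw δ lam u c * (if δ c t < m then 1 else 0)
      = ∑' r, lam r * ∑' c, uniformContact δ u r c * (if δ c t < m then 1 else 0) := by
        simp_rw [contactLaw, PMF.bind_apply, ← ENNReal.tsum_mul_right, ← ENNReal.tsum_mul_left]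
        rw [ENNReal.tsum_comm]
        simp_rw [mul_assoc]
    _ ≤ _ := ENNReal.tsum_le_tsum fun r =>
        mul_le_mul_right (H.tsum_uniformContact_le hu r hm hmd) _

/-- The potential of a node at distance `n` from the target. -/
def potential (lam : PMF ℕ) (K : ℝ) (n : ℕ) : ℝ≥0∞ :=
  ∑ m ∈ Finset.Ioc 0 n, ENNReal.ofReal (potentialStep lam K m)

-- The step w(m) with m < d can be lost only if the contact is closer than m, while w(d) is always
-- counted as lost. The expected loss is therefore the quantity bounded in
-- `potentialStep_add_tsum_le_one`.
open Classical in
theorem HasSparseHits.potential_le (H : HasSparseHits G δ t R C) (lam : PMF ℕ)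
    {next : List (V × V) → V → V → V} (hnext : IsGreedyRule G δ t next)
    (h : List (V × V)) (u : V) (hut : u ≠ t) (hu : δ u t ≤ R) :
    potential lam (4 * C) (δ u t) ≤
      1 + ∑' c, contactLaw δ lam u c * potential lam (4 * C) (δ (next h u c) t) := by
  have hd : 0 < δ u t := by
    obtain ⟨w, -, hw⟩ := H.closer u hut
    omega
  set w : ℕ → ℝ≥0∞ := fun m => ENNReal.ofReal (potentialStep lam (4 * C) m)
  set P := contactLaw δ lam u
  -- A grid step gains at most 1, so the new distance is bounded below whatever the tie-breaking
  -- does.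
  have hmin : ∀ c, min (δ u t - 1) (δ c t) ≤ δ (next h u c) t := by
    intro c
    rcases (hnext h u c hut).1 with h1 | h1
    · have := H.adj _ _ h1
      omega
    · rw [h1]
      exact min_le_right _ _
  have hlow : ∀ c, ∑ m ∈ Finset.Ioo 0 (δ u t), w m * (if δ c t < m then 0 else 1) ≤
      potential lam (4 * C) (δ (next h u c) t) := by
    intro c
    simp_rw [mul_ite, mul_zero, mul_one, ← ite_not (δ c t < _), ← Finset.sum_filter]
    refine Finset.sum_le_sum_of_subset fun m hm => ?_
    rw [Finset.mem_filter, Finset.mem_Ioo] at hm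
    have := hmin c
    rw [Finset.mem_Ioc]
    omega
  have hsplit : ∀ m, 1 = ∑' c, P c * (if δ c t < m then 0 else 1) +
      ∑' c, P c * (if δ c t < m then 1 else 0) := by
    intro m
    rw [← ENNReal.tsum_add, ← P.tsum_coe]
    refine tsum_congr fun c => ?_
    split_ifs <;> simp
  calc potential lam (4 * C) (δ u t)
      = ∑ m ∈ Finset.Ioo 0 (δ u t), w m + w (δ u t) := by
        unfold potential
        rw [← Finset.Ioo_insert_right hd, Finset.sum_insert (by simp), add_comm]
    _ = ∑ m ∈ Finset.Ioo 0 (δ u t), w m * ∑' c, P c * (if δ c t < m then 0 else 1) +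
          (w (δ u t) + ∑ m ∈ Finset.Ioo 0 (δ u t),
            w m * ∑' c, P c * (if δ c t < m then 1 else 0)) := by
        rw [add_comm (w (δ u t)), ← add_assoc, ← Finset.sum_add_distrib]
        congr 1
        refine Finset.sum_congr rfl fun m _ => ?_
        rw [← mul_add, ← hsplit, mul_one]
    _ ≤ ∑' c, P c * potential lam (4 * C) (δ (next h u c) t) + 1 := by
        refine add_le_add ?_ ?_
        · simp_rw [← ENNReal.tsum_mul_left]
          rw [← Summable.tsum_finsetSum fun _ _ => ENNReal.summable]
          refine ENNReal.tsum_le_tsum fun c => ?_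
          simp_rw [mul_left_comm (w _)]
          rw [← Finset.mul_sum]
          exact mul_le_mul_right (hlow c) _
        · refine le_trans (add_le_add_right (Finset.sum_le_sum fun m hm => ?_) _)
            (potentialStep_add_tsum_le_one lam (Nat.cast_nonneg C) hd)
          obtain ⟨hm0, hmd⟩ := Finset.mem_Ioo.mp hm
          exact mul_le_mul_right (H.tsum_contactLaw_le lam hu hm0 hmd) _
    _ = _ := add_comm _ _

theorem IsGreedyRule.dist_lt {next : List (V × V) → V → V → V} (hnext : IsGreedyRule G δ t next)
    (hcloser : ∀ u, u ≠ t → ∃ w, G.Adj u w ∧ δ w t < δ u t) (h : List (V × V)) (u c : V)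
    (hut : u ≠ t) : δ (next h u c) t < δ u t := by
  obtain ⟨w, hadj, hw⟩ := hcloser u hut
  exact ((hnext h u c hut).2 w (Or.inl hadj)).trans_lt hw

theorem HasSparseHits.le_expectedRoutingTime [Countable V] [MeasurableSpace V]
    [MeasurableSingletonClass V] {s : V} (H : HasSparseHits G δ t (δ s t) C) (lam : PMF ℕ)
    {next : List (V × V) → V → V → V} (hnext : IsGreedyRule G δ t next) (hst : 0 < δ s t) :
    ENNReal.ofReal (Real.log 2 ^ 2 / (2 + 12 * C) * Real.logb 2 (δ s t) ^ 2) ≤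
      expectedRoutingTime δ lam next s t := by
  have h1 := le_lintegral_routingTimeFrom δ lam (next := next) (t := t) (f := fun v => δ v t)
    (R := δ s t) (fun v => potential lam (4 * C) (δ v t)) (by simp [H.self, potential])
    (hnext.dist_lt H.closer) (H.potential_le lam hnext) [] s le_rfl
  simp_rw [expectedRoutingTime, routingTime_eq]
  refine le_trans ?_ h1
  unfold potential
  have hK : (0 : ℝ) ≤ 4 * C := by positivity
  rw [← ENNReal.ofReal_sum_of_nonneg fun m _ => potentialStep_nonneg lam hK m]
  refine ENNReal.ofReal_le_ofReal (le_trans (le_of_eq ?_) (log_sq_le_sum_potentialStep lam hK hst))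
  have hlog : Real.log 2 ≠ 0 := (Real.log_pos one_lt_two).ne'
  unfold Real.logb
  field_simp
  ring

end Greedy

/-! ### Counting lattice points in spheres -/

section Counting

variable {D : ℕ}

theorem l1norm_add_natAbs_of_eq_off {x y : Fin D → ℤ} (i : Fin D) (h : ∀ k, k ≠ i → x k = y k) :
    l1norm x + (y i).natAbs = l1norm y + (x i).natAbs := by
  unfold l1norm
  rw [← Finset.add_sum_erase _ _ (Finset.mem_univ i), ← Finset.add_sum_erase _ _ (Finset.mem_univ i),
    Finset.sum_congr rfl fun k hk => by rw [h k (Finset.ne_of_mem_erase hk)]]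
  ring

theorem natAbs_le_l1norm (x : Fin D → ℤ) (i : Fin D) : (x i).natAbs ≤ l1norm x :=
  Finset.single_le_sum (f := fun i => (x i).natAbs) (fun _ _ => Nat.zero_le _) (Finset.mem_univ i)

theorem l1norm_neg (x : Fin D → ℤ) : l1norm (-x) = l1norm x := by simp [l1norm]

theorem l1norm_add_le (x y : Fin D → ℤ) : l1norm (x + y) ≤ l1norm x + l1norm y := by
  unfold l1norm
  rw [← Finset.sum_add_distrib]
  exact Finset.sum_le_sum fun i _ => Int.natAbs_add_le _ _

theorem exists_l1norm_le_mul_natAbs (hD : 0 < D) (x : Fin D → ℤ) :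
    ∃ i, l1norm x ≤ D * (x i).natAbs := by
  have : (Finset.univ : Finset (Fin D)).Nonempty := ⟨⟨0, hD⟩, Finset.mem_univ _⟩
  obtain ⟨i, -, hi⟩ := Finset.exists_max_image Finset.univ (fun i => (x i).natAbs) this
  refine ⟨i, ?_⟩
  have := Finset.sum_le_card_nsmul Finset.univ (fun i => (x i).natAbs) _ hi
  simpa [l1norm] using this

/-- The sign of an integer, with the convention that `0` is positive. -/
def unitSign (z : ℤ) : ℤ := if 0 ≤ z then 1 else -1

/-- Moving mass `q` from coordinate `i` to coordinate `j`. -/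
def shiftMass (i j : Fin D) (q : ℤ) (x : Fin D → ℤ) : Fin D → ℤ :=
  Function.update (Function.update x i (x i - unitSign (x i) * q)) j (x j + unitSign (x j) * q)

theorem shiftMass_apply_left {i j : Fin D} (hij : i ≠ j) (q : ℤ) (x : Fin D → ℤ) :
    shiftMass i j q x i = x i - unitSign (x i) * q := by
  simp [shiftMass, Function.update_of_ne hij]

theorem shiftMass_apply_right (i j : Fin D) (q : ℤ) (x : Fin D → ℤ) :
    shiftMass i j q x j = x j + unitSign (x j) * q := by
  simp [shiftMass]

theorem shiftMass_apply_of_ne {i j k : Fin D} (hi : k ≠ i) (hj : k ≠ j) (q : ℤ) (x : Fin D → ℤ) :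
    shiftMass i j q x k = x k := by
  simp [shiftMass, Function.update_of_ne hi, Function.update_of_ne hj]

/-- Coordinate i moves towards 0 without crossing it, as q ≤ |x i|, and coordinate j moves away from
0, so the changes cancel. -/
theorem l1norm_shiftMass {i j : Fin D} (hij : i ≠ j) {q : ℕ} {x : Fin D → ℤ}
    (hq : q ≤ (x i).natAbs) : l1norm (shiftMass i j q x) = l1norm x := by
  set z := Function.update x i (x i - unitSign (x i) * q) with hz
  have h1 : l1norm z + (x i).natAbs = l1norm x + (z i).natAbs :=
    l1norm_add_natAbs_of_eq_off i fun k hk => Function.update_of_ne hk _ _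
  have h2 : l1norm (shiftMass i j q x) + (z j).natAbs =
      l1norm z + (shiftMass i j q x j).natAbs :=
    l1norm_add_natAbs_of_eq_off j fun k hk => Function.update_of_ne hk _ _
  have h3 : z i = x i - unitSign (x i) * q := Function.update_self _ _ _
  have h4 : z j = x j := Function.update_of_ne hij.symm _ _
  rw [shiftMass_apply_right, h4] at h2
  rw [h3] at h1
  unfold unitSign at h1 h2
  split_ifs at h1 h2 <;> omega

/-- If a set `A` of points within distance less than `m` of `b` is such that the intersection of the
`ℓ¹`-sphere through any of its points with a box around that point is contained in `S`, then `A` is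
small compared with `S`. -/
theorem card_mul_l1norm_le (hD : 2 ≤ D) {b : Fin D → ℤ} {m : ℕ} (hm : 0 < m)
    {A S : Finset (Fin D → ℤ)} (hA : ∀ a ∈ A, ∀ i, (a i - b i).natAbs < m)
    (hS : ∀ a ∈ A, ∀ y, (∀ i, (y i - a i).natAbs ≤ l1norm b) → l1norm y = l1norm a → y ∈ S) :
    A.card * l1norm b ≤ 4 * D * m * S.card := by
  set d := l1norm b
  rcases le_or_gt d (4 * D * m) with hd | hd
  -- Here the claim is weak enough to follow from A ⊆ S.
  · have : A.card ≤ S.card := Finset.card_le_card fun a ha => hS a ha a (by simp) rfl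
    calc A.card * d ≤ S.card * (4 * D * m) := Nat.mul_le_mul this hd
      _ = _ := mul_comm _ _
  obtain ⟨i, hi⟩ := exists_l1norm_le_mul_natAbs (by omega) b
  obtain ⟨j, hji⟩ : ∃ j : Fin D, j ≠ i :=
    haveI : Nontrivial (Fin D) := Fin.nontrivial_iff_two_le.mpr hD
    exists_ne i
  have hbi : 4 * m < (b i).natAbs := by
    by_contra! h
    have := Nat.mul_le_mul_left D h
    have e : D * (4 * m) = 4 * D * m := by ring
    omega
  -- The number of shifts, by 2mk for k < K. As |b i| ≥ d/D, they use at most half of |b i|, which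
  -- points of A can afford since they differ from b by less than m < |b i|/4 there.
  set K := d / (4 * D * m) + 1
  have hq : ∀ k < K, 2 * (2 * m * k) ≤ (b i).natAbs ∧ 2 * m * k ≤ d := by
    intro k hk
    have h1 : 4 * D * m * k ≤ d :=
      (Nat.mul_le_mul_left _ (Nat.lt_succ_iff.mp hk)).trans (Nat.mul_div_le _ _)
    constructor
    · refine le_of_mul_le_mul_left (a := D) ?_ (by omega)
      refine le_trans (le_of_eq ?_) (h1.trans hi)
      ring
    · refine le_trans ?_ h1
      gcongr
      omega
  have hqA : ∀ a ∈ A, ∀ k < K, 2 * m * k ≤ (a i).natAbs := by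
    intro a ha k hk
    have h1 := (hq k hk).1
    have h2 := hA a ha i
    omega
  have hcard : (A ×ˢ Finset.range K).card ≤ S.card := by
    refine Finset.card_le_card_of_injOn (fun p => shiftMass i j ((2 * m * p.2 : ℕ) : ℤ) p.1) ?_ ?_
    · rintro ⟨a, k⟩ hp
      obtain ⟨ha, hk⟩ := Finset.mem_product.mp (Finset.mem_coe.mp hp)
      have hk' := Finset.mem_range.mp hk
      refine hS a ha _ (fun l => ?_) (l1norm_shiftMass hji.symm (hqA a ha k hk'))
      have h2 := (hq k hk').2
      dsimp only
      by_cases hli : l = i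
      · subst hli
        rw [shiftMass_apply_left hji.symm]
        unfold unitSign
        split_ifs <;> omega
      · by_cases hlj : l = j
        · subst hlj
          rw [shiftMass_apply_right]
          unfold unitSign
          split_ifs <;> omega
        · rw [shiftMass_apply_of_ne hli hlj, sub_self]
          exact Nat.zero_le _
    · rintro ⟨a, k⟩ hp ⟨a', k'⟩ hp' heq
      obtain ⟨ha, hk⟩ := Finset.mem_product.mp (Finset.mem_coe.mp hp)
      obtain ⟨ha', hk'⟩ := Finset.mem_product.mp (Finset.mem_coe.mp hp')
      have hk := Finset.mem_range.mp hk
      have hk' := Finset.mem_range.mp hk'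
      dsimp only at ha ha' hk hk' heq
      have hl := fun l => congrFun heq l
      have hj := hl j
      have hi' := hl i
      rw [shiftMass_apply_right, shiftMass_apply_right] at hj
      rw [shiftMass_apply_left hji.symm, shiftMass_apply_left hji.symm] at hi'
      have b1 := hA a ha j
      have b2 := hA a' ha' j
      have b3 := hA a ha i
      have b4 := hA a' ha' i
      -- The j-coordinates of points of A differ by less than 2m, so distinct multiples of 2m
      -- separate the images. Opposite signs cannot collide, as the shift preserves the sign of
      -- coordinate j.
      have hkk : k = k' := by
        rcases lt_trichotomy k k' with h | h | h
        · have h3 : 2 * m * k + 2 * m ≤ 2 * m * k' := by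
            rw [← Nat.mul_succ]; exact Nat.mul_le_mul_left _ h
          unfold unitSign at hj
          split_ifs at hj <;> omega
        · exact h
        · have h3 : 2 * m * k' + 2 * m ≤ 2 * m * k := by
            rw [← Nat.mul_succ]; exact Nat.mul_le_mul_left _ h
          unfold unitSign at hj
          split_ifs at hj <;> omega
      subst hkk
      have haa : a = a' := by
        funext l
        by_cases hli : l = i
        · subst hli
          unfold unitSign at hi'
          split_ifs at hi' <;> omega
        · by_cases hlj : l = j
          · subst hlj
            unfold unitSign at hj
            split_ifs at hj <;> omega
          · have := hl l
            rwa [shiftMass_apply_of_ne hli hlj, shiftMass_apply_of_ne hli hlj] at this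
      rw [haa]
  rw [Finset.card_product, Finset.card_range] at hcard
  have hpos : 0 < 4 * D * m := Nat.mul_pos (by omega) hm
  calc A.card * d ≤ A.card * (4 * D * m * K) :=
        Nat.mul_le_mul_left _ (Nat.lt_mul_div_succ d hpos).le
    _ = 4 * D * m * (A.card * K) := by ring
    _ ≤ _ := Nat.mul_le_mul_left _ hcard

/-- `card_mul_l1norm_le`, read through an injective chart. -/
theorem card_mul_l1norm_chart_le {V : Type*} (hD : 2 ≤ D) {x : V → Fin D → ℤ}
    (hx : Function.Injective x) {t : V} {m : ℕ} (hm : 0 < m) {A S : Finset V}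
    (hA : ∀ a ∈ A, ∀ i, (x a i - x t i).natAbs < m)
    (hS : ∀ a ∈ A, ∀ y, (∀ i, (y i - x a i).natAbs ≤ l1norm (x t)) → l1norm y = l1norm (x a) →
      ∃ v ∈ S, x v = y) :
    A.card * l1norm (x t) ≤ 4 * D * m * S.card := by
  have h := card_mul_l1norm_le hD (b := x t) hm (A := A.map ⟨x, hx⟩) (S := S.map ⟨x, hx⟩)
    (by simpa using hA) (by simpa using hS)
  simpa using h

end Counting

/-! ### The infinite grid -/

section Lattice

variable {D : ℕ}

theorem manhattan_comm (u v : Fin D → ℤ) : manhattan u v = manhattan v u := by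
  rw [manhattan, manhattan, ← l1norm_neg, neg_sub]

theorem manhattan_triangle (u v w : Fin D → ℤ) : manhattan u w ≤ manhattan u v + manhattan v w := by
  unfold manhattan
  rw [← sub_add_sub_cancel u v w]
  exact l1norm_add_le _ _

theorem manhattan_self (u : Fin D → ℤ) : manhattan u u = 0 := by simp [manhattan, l1norm]

theorem manhattan_eq_natAbs {u w : Fin D → ℤ} {i : Fin D} (h : ∀ k, k ≠ i → u k = w k) :
    manhattan u w = (u i - w i).natAbs := by
  have := l1norm_add_natAbs_of_eq_off (x := u - w) (y := 0) i (fun k hk => by simp [h k hk])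
  simpa [manhattan, l1norm] using this

theorem manhattan_lt_of_step {u w t : Fin D → ℤ} {i : Fin D} (h : ∀ k, k ≠ i → u k = w k)
    (hi : (w i - t i).natAbs < (u i - t i).natAbs) : manhattan w t < manhattan u t := by
  have := l1norm_add_natAbs_of_eq_off (x := u - t) (y := w - t) i
    (fun k hk => by simp [h k hk])
  simp only [Pi.sub_apply] at this
  unfold manhattan
  omega

/-- The chart translates `u` to the origin. Every lattice point of the right norm lies on the
sphere, so the box restriction is not needed. -/
theorem hasSparseHits_lattice (hD : 2 ≤ D) (t : Fin D → ℤ) (R : ℕ) :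
    HasSparseHits (latticeGraph D) manhattan t R (4 * D) where
  self := manhattan_self t
  adj u w h := by
    have h1 : manhattan u w = 1 := h
    have := manhattan_triangle u w t
    omega
  closer u hut := by
    obtain ⟨i, hi⟩ := Function.ne_iff.mp hut
    have hoff : ∀ k, k ≠ i → u k = Function.update u i (if u i < t i then u i + 1 else u i - 1) k :=
      fun k hk => (Function.update_of_ne hk _ _).symm
    refine ⟨_, ?_, manhattan_lt_of_step hoff ?_⟩
    · change manhattan _ _ = 1
      rw [manhattan_eq_natAbs hoff, Function.update_self]
      split_ifs <;> omega
    · rw [Function.update_self]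
      split_ifs <;> omega
  triangle u v := manhattan_triangle u v t
  triangle' u v := by
    rw [manhattan_comm v t]
    exact manhattan_triangle u t v
  count u r m _ hm _ S A hA hS := by
    have hd : ∀ v, manhattan u v = l1norm (v - u) := fun v => manhattan_comm u v
    rw [hd]
    refine card_mul_l1norm_chart_le hD (x := fun v => v - u) sub_left_injective hm
      (fun a ha i => ?_) (fun a ha y _ hy => ⟨u + y, hS _ ?_, add_sub_cancel_left u y⟩)
    · have := natAbs_le_l1norm (a - t) i
      have := (hA a ha).2
      unfold manhattan at this
      simp only [Pi.sub_apply] at *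
      omega
    · rw [hd, add_sub_cancel_left, hy, ← hd, (hA a ha).1]

end Lattice

/-! ### The finite grid -/

section Grid

variable {D n : ℕ}

theorem toLattice_injective : Function.Injective (toLattice : (Fin D → Fin n) → Fin D → ℤ) := by
  intro u v h
  funext i
  have := congrFun h i
  simp only [toLattice, Nat.cast_inj] at this
  exact Fin.ext this

theorem exists_toLattice_eq {y : Fin D → ℤ} (h : ∀ i, 0 ≤ y i ∧ y i < n) :
    ∃ v : Fin D → Fin n, toLattice v = y :=
  ⟨fun i => ⟨(y i).toNat, by have := h i; omega⟩, by
    funext i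
    have := h i
    simp only [toLattice]
    omega⟩

/-- Projecting t to the two faces orthogonal to axis i turns the distance condition on border nodes
into bounds on each coordinate. -/
theorem gridDist_border_eq {t : Fin D → Fin n} (hn : 0 < n) (i : Fin D) :
    (∃ b ∈ border D n, gridDist t b = (t i : ℕ)) ∧
      ∃ b ∈ border D n, gridDist t b = n - 1 - (t i : ℕ) := by
  have key : ∀ z : Fin n, gridDist t (Function.update t i z) = ((t i : ℤ) - (z : ℤ)).natAbs := by
    intro z
    have h := manhattan_eq_natAbs (u := toLattice t) (w := toLattice (Function.update t i z)) (i := i)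
      (fun k hk => by simp [toLattice, Function.update_of_ne hk])
    simpa [toLattice, gridDist] using h
  have hti := (t i).isLt
  refine ⟨⟨Function.update t i ⟨0, hn⟩, ⟨i, Or.inl (by simp)⟩, ?_⟩,
    ⟨Function.update t i ⟨n - 1, by omega⟩, ⟨i, Or.inr ?_⟩, ?_⟩⟩
  · rw [key]; simp
  · simp only [Function.update_self]; omega
  · rw [key]; simp only; omega

theorem hasSparseHits_grid (hD : 2 ≤ D) (t : Fin D → Fin n) {R : ℕ}
    (hR : ∀ b ∈ border D n, 2 * R ≤ gridDist t b) :
    HasSparseHits (gridGraph D n) gridDist t R (4 * D) := by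
  have hn : 0 < n := (t ⟨0, by omega⟩).pos
  have L := hasSparseHits_lattice hD (toLattice t) R
  refine ⟨L.self, fun u w h => L.adj _ _ h, fun u hut => ?_, fun u v => L.triangle _ _,
    fun u v => L.triangle' _ _, fun u r m hu hm hmd S A hA hS => ?_⟩
  · obtain ⟨i, hi⟩ := Function.ne_iff.mp hut
    have hi' : (u i : ℕ) ≠ t i := fun h => hi (Fin.ext h)
    have hui := (u i).isLt
    have hti := (t i).isLt
    obtain ⟨z, hz⟩ : ∃ z : Fin n, ((u i : ℕ) < t i ∧ (z : ℕ) = u i + 1) ∨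
        ((t i : ℕ) < u i ∧ (z : ℕ) + 1 = u i) := by
      rcases lt_or_gt_of_ne hi' with h | h
      · exact ⟨⟨u i + 1, by omega⟩, Or.inl ⟨h, rfl⟩⟩
      · exact ⟨⟨u i - 1, by omega⟩, Or.inr ⟨h, by simp only; omega⟩⟩
    have hoff : ∀ k, k ≠ i → toLattice u k = toLattice (Function.update u i z) k :=
      fun k hk => by simp [toLattice, Function.update_of_ne hk]
    refine ⟨Function.update u i z, ?_, manhattan_lt_of_step hoff ?_⟩
    · change manhattan _ _ = 1
      rw [manhattan_eq_natAbs hoff]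
      simp only [toLattice, Function.update_self]
      omega
    · simp only [toLattice, Function.update_self]
      omega
  · have hd : ∀ v, gridDist u v = l1norm (toLattice v - toLattice u) := fun v => manhattan_comm _ _
    have hu' := hu
    rw [hd] at hu' hmd ⊢
    refine card_mul_l1norm_chart_le hD (x := fun v : Fin D → Fin n => toLattice v - toLattice u)
      (fun v w h => toLattice_injective (sub_left_injective h)) hm
      (fun a ha i => ?_) (fun a ha y hy hya => ?_)
    · have h1 := natAbs_le_l1norm (toLattice a - toLattice t) i
      have h2 := (hA a ha).2
      unfold gridDist manhattan at h2
      simp only [Pi.sub_apply] at *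
      omega
    -- The box restriction keeps shifted points inside the grid: a is within m < d ≤ R of t, the
    -- shift changes a coordinate by at most d, and t is 2R away from the border.
    · obtain ⟨v, hv⟩ : ∃ v : Fin D → Fin n, toLattice v = toLattice u + y := by
        refine exists_toLattice_eq fun i => ?_
        obtain ⟨⟨b₁, hb₁, e₁⟩, ⟨b₂, hb₂, e₂⟩⟩ := gridDist_border_eq (t := t) hn i
        have h1 := hR b₁ hb₁
        have h2 := hR b₂ hb₂
        have h3 := natAbs_le_l1norm (toLattice a - toLattice t) i
        have h4 := (hA a ha).2
        have h5 := hy i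
        unfold gridDist manhattan at h4
        simp only [Pi.sub_apply, Pi.add_apply, toLattice] at *
        omega
      refine ⟨v, hS v ?_, ?_⟩
      · rw [hd, hv, add_sub_cancel_left, hya, ← hd, (hA a ha).1]
      · simp only [hv, add_sub_cancel_left]

end Grid

/-! ### The torus -/

section Torus

variable {D n : ℕ}

/-- The representative with minimal absolute values of a vector modulo `n`. -/
def minLift (x : Fin D → ZMod n) : Fin D → ℤ := fun i => (x i).valMinAbs

theorem minLift_injective : Function.Injective (minLift : (Fin D → ZMod n) → Fin D → ℤ) :=
  fun _ _ h => funext fun i => ZMod.injective_valMinAbs (congrFun h i)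

theorem l1norm_minLift_add_le (x y : Fin D → ZMod n) :
    l1norm (minLift (x + y)) ≤ l1norm (minLift x) + l1norm (minLift y) := by
  refine le_trans (Finset.sum_le_sum fun i _ => ?_) (l1norm_add_le (minLift x) (minLift y))
  exact ZMod.natAbs_valMinAbs_add_le _ _

theorem minLift_intCast [NeZero n] {y : Fin D → ℤ} (h : 2 * l1norm y < n) :
    minLift (fun i => ((y i : ℤ) : ZMod n)) = y := by
  funext i
  have := natAbs_le_l1norm y i
  refine (ZMod.valMinAbs_spec _ _).mpr ⟨rfl, ?_⟩
  rw [Set.mem_Ioc]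
  omega

theorem natAbs_valMinAbs_one_le : ((1 : ZMod n).valMinAbs).natAbs ≤ 1 := by
  rcases n with _ | _ | n
  · simp
  · exact (ZMod.natAbs_valMinAbs_le (1 : ZMod (0 + 1))).trans (by norm_num)
  · have h : ((1 : ℕ) : ZMod (n + 2)).valMinAbs = (1 : ℕ) :=
      ZMod.valMinAbs_natCast_of_le_half (by omega)
    rw [Nat.cast_one] at h
    simp [h]

theorem l1norm_minLift_sub_le_of_adj {u v : Fin D → ZMod n} (h : (torusGraph D n).Adj u v) :
    l1norm (minLift (u - v)) ≤ 1 := by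
  obtain ⟨-, i, hoff, hi⟩ := h
  have h1 := l1norm_add_natAbs_of_eq_off (x := minLift (u - v)) (y := 0) i
    (fun k hk => by simp [minLift, hoff k hk])
  have h2 : (minLift (u - v) i).natAbs ≤ 1 := by
    rcases hi with hi | hi
    · have : minLift (u - v) i = (-1 : ZMod n).valMinAbs := by
        simp [minLift, hi]
      rw [this, ZMod.natAbs_valMinAbs_neg]
      exact natAbs_valMinAbs_one_le
    · have : minLift (u - v) i = (1 : ZMod n).valMinAbs := by
        simp [minLift, hi]
      rw [this]
      exact natAbs_valMinAbs_one_le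
  have h3 : l1norm (0 : Fin D → ℤ) = 0 := by simp [l1norm]
  simp only [Pi.zero_apply, Int.natAbs_zero] at h1
  omega

/-- Moving a nonzero minimal residue one unit towards 0 leaves it minimal. -/
theorem exists_torus_step [NeZero n] {u t : Fin D → ZMod n} (hut : u ≠ t) :
    ∃ w, (torusGraph D n).Adj u w ∧ l1norm (minLift (w - t)) + 1 = l1norm (minLift (u - t)) := by
  obtain ⟨i, hi⟩ := Function.ne_iff.mp hut
  set z := (u i - t i).valMinAbs with hz
  have hz0 : z ≠ 0 := by
    rw [hz, Ne, ZMod.valMinAbs_eq_zero, sub_eq_zero]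
    exact hi
  have hzb := ZMod.valMinAbs_mem_Ioc (u i - t i)
  rw [← hz, Set.mem_Ioc] at hzb
  obtain ⟨e, he, hze⟩ : ∃ e : ℤ, (e = 1 ∨ e = -1) ∧ (z - e).natAbs + 1 = z.natAbs := by
    rcases lt_or_gt_of_ne hz0 with h | h
    · exact ⟨-1, Or.inr rfl, by omega⟩
    · exact ⟨1, Or.inl rfl, by omega⟩
  set w := Function.update u i (u i - (e : ZMod n)) with hw
  have hwi : w i = u i - (e : ZMod n) := Function.update_self _ _ _
  have hoff : ∀ k, k ≠ i → u k = w k := fun k hk => (Function.update_of_ne hk _ _).symm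
  have hlift : minLift (w - t) i = z - e := by
    refine (ZMod.valMinAbs_spec _ _).mpr ⟨?_, ?_⟩
    · rw [Int.cast_sub, hz, ZMod.coe_valMinAbs, Pi.sub_apply, hwi]
      ring
    · rw [Set.mem_Ioc]
      omega
  have hnorm : l1norm (minLift (w - t)) + 1 = l1norm (minLift (u - t)) := by
    have h := l1norm_add_natAbs_of_eq_off (x := minLift (u - t)) (y := minLift (w - t)) i
      (fun k hk => by simp [minLift, hoff k hk])
    have h' : minLift (u - t) i = z := rfl
    rw [hlift, h'] at h
    omega
  refine ⟨w, ⟨fun h => ?_, i, hoff, ?_⟩, hnorm⟩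
  · rw [← h] at hnorm
    omega
  · rw [hwi]
    rcases he with rfl | rfl
    · right; simp
    · left; simp

theorem torus_exists_walk [NeZero n] (u t : Fin D → ZMod n) :
    ∃ p : (torusGraph D n).Walk u t, p.length = l1norm (minLift (u - t)) := by
  induction hk : l1norm (minLift (u - t)) using Nat.strong_induction_on generalizing u with
  | _ k ih =>
    by_cases hut : u = t
    · subst hut
      exact ⟨.nil, by rw [← hk]; simp [minLift, l1norm]⟩
    · obtain ⟨w, hadj, hw⟩ := exists_torus_step hut
      obtain ⟨p, hp⟩ := ih _ (by omega) w rfl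
      exact ⟨.cons hadj p, by rw [SimpleGraph.Walk.length_cons, hp]; omega⟩

theorem l1norm_minLift_sub_le_length {u v : Fin D → ZMod n} (p : (torusGraph D n).Walk u v) :
    l1norm (minLift (u - v)) ≤ p.length := by
  induction p with
  | nil => simp [minLift, l1norm]
  | @cons a b c h p ih =>
    have h1 := l1norm_minLift_sub_le_of_adj h
    have h2 := l1norm_minLift_add_le (a - b) (b - c)
    rw [sub_add_sub_cancel] at h2
    rw [SimpleGraph.Walk.length_cons]
    omega

/-- Unit steps towards the target give a walk of this length. Subadditivity of the minimal lift
along a walk shows that none is shorter. -/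
theorem torusDist_eq [NeZero n] (u v : Fin D → ZMod n) : torusDist u v = l1norm (minLift (u - v)) := by
  obtain ⟨p, hp⟩ := torus_exists_walk u v
  refine le_antisymm (hp ▸ SimpleGraph.dist_le p) ?_
  obtain ⟨q, hq⟩ := p.reachable.exists_walk_length_eq_dist
  rw [torusDist, ← hq]
  exact l1norm_minLift_sub_le_length q

theorem torusDist_comm (u v : Fin D → ZMod n) : torusDist u v = torusDist v u :=
  SimpleGraph.dist_comm

theorem torusDist_triangle [NeZero n] (u v w : Fin D → ZMod n) :
    torusDist u w ≤ torusDist u v + torusDist v w := by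
  simp_rw [torusDist_eq, ← sub_add_sub_cancel u v w]
  exact l1norm_minLift_add_le _ _

theorem minLift_add [NeZero n] {x y : Fin D → ZMod n}
    (h : 2 * (l1norm (minLift x) + l1norm (minLift y)) < n) :
    minLift (x + y) = minLift x + minLift y := by
  funext i
  have h1 := natAbs_le_l1norm (minLift x) i
  have h2 := natAbs_le_l1norm (minLift y) i
  refine (ZMod.valMinAbs_spec _ _).mpr ⟨by simp [minLift], ?_⟩
  rw [Set.mem_Ioc, Pi.add_apply]
  omega

/-- The chart is the minimal lift of v - u. Since d ≤ n/4, hit points and their shifts have norm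
below n/2, so nothing wraps around and the count is that of the lattice. -/
theorem hasSparseHits_torus [NeZero n] (hD : 2 ≤ D) (t : Fin D → ZMod n) {R : ℕ}
    (hR : 4 * R ≤ n) : HasSparseHits (torusGraph D n) torusDist t R (4 * D) where
  self := SimpleGraph.dist_self
  adj u w h := by
    have h1 : torusDist u w ≤ 1 := by
      rw [torusDist_eq]; exact l1norm_minLift_sub_le_of_adj h
    have := torusDist_triangle u w t
    omega
  closer u hut := by
    obtain ⟨w, hadj, hw⟩ := exists_torus_step hut
    exact ⟨w, hadj, by rw [torusDist_eq, torusDist_eq]; omega⟩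
  triangle u v := torusDist_triangle u v t
  triangle' u v := by
    rw [torusDist_comm v t]
    exact torusDist_triangle u t v
  count u r m hu hm hmd S A hA hS := by
    have hd : ∀ v, torusDist u v = l1norm (minLift (v - u)) := fun v => by
      rw [torusDist_comm, torusDist_eq]
    have hn : ∀ a ∈ A, 2 * (l1norm (minLift (t - u)) + l1norm (minLift (a - t))) < n := by
      intro a ha
      have h1 := (hA a ha).2
      rw [torusDist_eq] at h1
      rw [hd] at hu hmd
      omega
    have hadd : ∀ a ∈ A, minLift (a - u) = minLift (t - u) + minLift (a - t) := by
      intro a ha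
      rw [← minLift_add (hn a ha), add_comm, sub_add_sub_cancel]
    rw [hd]
    refine card_mul_l1norm_chart_le hD (x := fun v => minLift (v - u))
      (fun v w h => sub_left_injective (minLift_injective h)) hm
      (fun a ha i => ?_) (fun a ha y _ hya => ?_)
    · have h1 := natAbs_le_l1norm (minLift (a - t)) i
      have h2 := (hA a ha).2
      rw [torusDist_eq] at h2
      simp only [hadd a ha, Pi.add_apply, add_sub_cancel_left]
      omega
    · have hy : minLift (fun i => ((y i : ℤ) : ZMod n)) = y := by
        refine minLift_intCast ?_
        have h1 := hn a ha
        have h2 := l1norm_add_le (minLift (t - u)) (minLift (a - t))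
        rw [hadd a ha] at hya
        omega
      refine ⟨u + fun i => ((y i : ℤ) : ZMod n), hS _ ?_, ?_⟩
      · rw [hd, add_sub_cancel_left, hy, hya, ← hd, (hA a ha).1]
      · simp only [add_sub_cancel_left, hy]

end Torus

end SmallWorld

end

/-! ### The lower bound on the three networks -/

theorem theorem2 (D : ℕ) (hD : 2 ≤ D) :
    ∃ c : ℝ, 0 < c ∧
      -- the infinite grid
      (∀ (lam : PMF ℕ) (next : List ((Fin D → ℤ) × (Fin D → ℤ)) →
            (Fin D → ℤ) → (Fin D → ℤ) → (Fin D → ℤ)),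
        SmallWorld.IsGreedyRule (SmallWorld.latticeGraph D) SmallWorld.manhattan 0 next →
        ∀ s : Fin D → ℤ, s ≠ 0 →
          ENNReal.ofReal (c * Real.logb 2 (SmallWorld.l1norm s) ^ 2) ≤
            SmallWorld.expectedRoutingTime SmallWorld.manhattan lam next s 0) ∧
      -- the finite torus
      (∀ (n : ℕ) [NeZero n] (lam : PMF ℕ) (s t : Fin D → ZMod n)
          (next : List ((Fin D → ZMod n) × (Fin D → ZMod n)) →
            (Fin D → ZMod n) → (Fin D → ZMod n) → (Fin D → ZMod n)),
        SmallWorld.IsGreedyRule (SmallWorld.torusGraph D n) SmallWorld.torusDist t next →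
        s ≠ t → (SmallWorld.torusDist s t : ℝ) ≤ (n : ℝ) / 4 →
          ENNReal.ofReal (c * Real.logb 2 (SmallWorld.torusDist s t) ^ 2) ≤
            SmallWorld.expectedRoutingTime SmallWorld.torusDist lam next s t) ∧
      -- the finite grid
      (∀ (n : ℕ) (lam : PMF ℕ) (s t : Fin D → Fin n)
          (next : List ((Fin D → Fin n) × (Fin D → Fin n)) →
            (Fin D → Fin n) → (Fin D → Fin n) → (Fin D → Fin n)),
        SmallWorld.IsGreedyRule (SmallWorld.gridGraph D n) SmallWorld.gridDist t next →
        s ≠ t →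
        (∀ b ∈ SmallWorld.border D n,
          2 * SmallWorld.gridDist s t ≤ SmallWorld.gridDist s b ∧
          2 * SmallWorld.gridDist s t ≤ SmallWorld.gridDist t b) →
          ENNReal.ofReal (c * Real.logb 2 (SmallWorld.gridDist s t) ^ 2) ≤
            SmallWorld.expectedRoutingTime SmallWorld.gridDist lam next s t) := by
  -- All three networks have C = 4D. The term 12C is 3K with K = 4C, and (log 2)² converts to base
  -- 2.
  have hC : (0 : ℝ) < Real.log 2 ^ 2 / (2 + 12 * (4 * D : ℕ)) := by
    have := Real.log_pos one_lt_two
    positivity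
  refine ⟨_, hC, fun lam next hnext s hs => ?_, fun n _ lam s t next hnext hst hsn => ?_,
    fun n lam s t next hnext hst hb => ?_⟩
  · have H := SmallWorld.hasSparseHits_lattice hD 0 (SmallWorld.manhattan s 0)
    obtain ⟨w, -, hw⟩ := H.closer s hs
    have h := H.le_expectedRoutingTime lam hnext (Nat.zero_lt_of_lt hw)
    rwa [show SmallWorld.manhattan s 0 = SmallWorld.l1norm s by simp [SmallWorld.manhattan]] at h
  · have hR : 4 * SmallWorld.torusDist s t ≤ n := by
      rw [le_div_iff₀ (by norm_num)] at hsn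
      have : SmallWorld.torusDist s t * 4 ≤ n := by exact_mod_cast hsn
      omega
    have H := SmallWorld.hasSparseHits_torus hD t hR
    obtain ⟨w, -, hw⟩ := H.closer s hst
    have : Countable (Fin D → ZMod n) := Finite.to_countable
    exact H.le_expectedRoutingTime lam hnext (Nat.zero_lt_of_lt hw)
  · have H := SmallWorld.hasSparseHits_grid hD t fun b hbb => (hb b hbb).2
    obtain ⟨w, -, hw⟩ := H.closer s hst
    exact H.le_expectedRoutingTime lam hnext (Nat.zero_lt_of_lt hw)
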